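/- **Proposition 3.4 (Regret bound of FTRL).** Let $d\ge 1$, $k\ge 0$ be integers and $\alpha>0$. Write $\langle A,B\rangle=\operatorname{Tr}(A^\top B)$ for real $d\times d$ matrices, let $\Delta_d=\{A\in\mathbb R^{d\times d}: A \text{ symmetric positive semidefinite},\ \operatorname{Tr}A=1\}$, and let $F_1,\dots,F_k$ be symmetric positive semidefinite $d\times d$ real matrices. Suppose that $A_1,\dots,A_k\in\Delta_d$ are selected by Follow-the-Regularized-Leader (FTRL) with regularizer $w:\Delta_d\to\mathbb R$ and learning rate $\alpha$, that is, for every $t\in\{1,\dots,k\}$, $$A_t\in\operatorname*{arg\,min}_{A\in\Delta_d}\Big\{\alpha\sum_{s=1}^{t-1}\langle A,F_s\rangle+w(A)\Big\}$$ (so $A_1$ minimizes $w$ over $\Delta_d$). Define the regret $$R=\sum_{t=1}^k\langle A_t,F_t\rangle-\inf_{U\in\Delta_d}\Big\langle U,\sum_{t=1}^kF_t\Big\rangle .$$ 1. If $w$ is the entropy regularizer $w(A)=\langle A,\log A-I\rangle$ (with the convention $0\log 0=0$ on zero eigenvalues), then $$R\le\frac{\log d}{\alpha}+\sum_{t=1}^k\langle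 A_t,F_t\rangle-\frac1\alpha\sum_{t=1}^k\Big(1-\langle A_t,\exp(-\alpha F_t)\rangle\Big).$$ 2. If $w$ is the $\ell_{1/2}$ regularizer $w(A)=-2\operatorname{Tr}(A^{1/2})$, then every $A_t$ is positive definite (so that the inverses below exist), and $$R\le\frac{2\sqrt d}{\alpha}+\sum_{t=1}^k\langle A_t,F_t\rangle-\frac1\alpha\sum_{t=1}^k\operatorname{Tr}\Big[A_t^{1/2}-\big(A_t^{-1/2}+\alpha F_t\big)^{-1}\Big].$$ -/

import Mathlib

namespace FTRL

/-- The inner product `⟨A, B⟩ = Tr(Aᵀ B)` of real square matrices. -/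
def ip {d : ℕ} (A B : Matrix (Fin d) (Fin d) ℝ) : ℝ :=
  (A.transpose * B).trace

/-- The spectraplex: symmetric positive semidefinite real matrices of trace one. -/
def spectraplex (d : ℕ) : Set (Matrix (Fin d) (Fin d) ℝ) :=
  {A | A.PosSemidef ∧ A.trace = 1}

/-- The matrix logarithm of a symmetric matrix, through the spectral functional calculus.
Zero eigenvalues are sent to `Real.log 0 = 0`, so that `⟨A, log A⟩` carries the usual
convention `0 log 0 = 0` on singular positive semidefinite matrices. -/
noncomputable def matLog {d : ℕ} (A : Matrix (Fin d) (Fin d) ℝ) : Matrix (Fin d) (Fin d) ℝ :=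
  cfc Real.log A

/-- The positive semidefinite square root `A^{1/2}` of a positive semidefinite matrix,
through the spectral functional calculus. -/
noncomputable def matSqrt {d : ℕ} (A : Matrix (Fin d) (Fin d) ℝ) : Matrix (Fin d) (Fin d) ℝ :=
  cfc Real.sqrt A

/-- The entropy regularizer `w(A) = ⟨A, log A - I⟩`. -/
noncomputable def entropyReg {d : ℕ} (A : Matrix (Fin d) (Fin d) ℝ) : ℝ :=
  ip A (matLog A - 1)

/-- The `ℓ_{1/2}` regularizer `w(A) = -2 Tr(A^{1/2})`. -/
noncomputable def halfReg {d : ℕ} (A : Matrix (Fin d) (Fin d) ℝ) : ℝ :=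
  -2 * (matSqrt A).trace

/-- The actions `A` are selected by Follow-the-Regularized-Leader with regularizer `w` and
learning rate `α` against the losses `F`: each `A t` is a minimizer over the spectraplex of
`α ∑_{s < t} ⟨B, F s⟩ + w(B)`. In the first round the sum is empty and `A t` minimizes `w`. -/
def IsFTRL {d k : ℕ} (w : Matrix (Fin d) (Fin d) ℝ → ℝ) (α : ℝ)
    (A F : Fin k → Matrix (Fin d) (Fin d) ℝ) : Prop :=
  ∀ t : Fin k, A t ∈ spectraplex d ∧
    IsMinOn (fun B => α * ∑ s ∈ Finset.Iio t, ip B (F s) + w B) (spectraplex d) (A t)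

/-- The total regret `∑_t ⟨A_t, F_t⟩ - inf_{U ∈ spectraplex} ⟨U, ∑_t F_t⟩`. -/
noncomputable def regret {d k : ℕ} (A F : Fin k → Matrix (Fin d) (Fin d) ℝ) : ℝ :=
  ∑ t, ip (A t) (F t) - sInf ((fun U => ip U (∑ t, F t)) '' spectraplex d)

end FTRL

/-! Let V_t be the minimum over the spectraplex of α∑_{s<t}⟨B,F_s⟩ + w(B). If V_{t+1} - V_t ≥ b_t
and m ≤ w ≤ M, telescoping from V_1 ≥ m gives α⟨U,∑F_t⟩ + M ≥ m + ∑b_t for every U, which is a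
regret bound (`regret_le_of_step`). It remains to find b_t.

Both regularizers are w(A) = Tr f(A). A scalar Fenchel–Young inequality xy + f(x) + g(y) ≥ 0, with
equality only at x = φ(y), lifts to traces even when the matrices do not commute. Hence, with H the
scaled past loss and l the multiplier giving trace one, the minimizer is A = φ(H + l). Testing the
next problem with the same l gives growth at least Tr g(H + l) - Tr g(H + l + E), where E = αF_t
(`FenchelPair.step`).

For entropy, g = φ = exp(-·), the first trace is 1, and Golden–Thompson bounds the second by ⟨A,
exp(-E)⟩. For ℓ_{1/2}, g(y) = 1/y and φ(y) = 1/y², so H + l = A^{-1/2} and the bound is already the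
claimed one. -/

namespace FTRL

/-! ### Fenchel–Young inequalities for traces -/

section FenchelYoung

open Matrix

variable {n : Type*} [Fintype n] [DecidableEq n] {A B : Matrix n n ℝ}

lemma trace_diagonal_mul_diagonal_transpose (u v : n → ℝ) (W : Matrix n n ℝ) :
    (diagonal u * W * diagonal v * Wᵀ).trace = ∑ i, ∑ j, W i j ^ 2 * (u i * v j) := by
  simp only [trace, diag_apply]
  refine Finset.sum_congr rfl fun i _ => ?_
  rw [mul_apply]
  refine Finset.sum_congr rfl fun j _ => ?_
  rw [mul_diagonal, diagonal_mul, transpose_apply]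
  ring

/-- The overlap matrix of the eigenbases of two symmetric matrices. -/
noncomputable def overlap (hA : A.IsHermitian) (hB : B.IsHermitian) : Matrix n n ℝ :=
  star (hA.eigenvectorUnitary : Matrix n n ℝ) * (hB.eigenvectorUnitary : Matrix n n ℝ)

/-- Diagonalizing both matrices leaves squared overlaps as nonnegative weights on pairs of
eigenvalues. Taking f or g constant 1 puts one-matrix traces on the same weights, so scalar
inequalities lift termwise. -/
lemma trace_cfc_mul_cfc (hA : A.IsHermitian) (hB : B.IsHermitian) (f g : ℝ → ℝ) :
    (cfc f A * cfc g B).trace =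
      ∑ i, ∑ j, overlap hA hB i j ^ 2 * (f (hA.eigenvalues i) * g (hB.eigenvalues j)) := by
  have key := trace_diagonal_mul_diagonal_transpose (f ∘ hA.eigenvalues) (g ∘ hB.eigenvalues)
    (overlap hA hB)
  simp only [Function.comp_apply] at key
  rw [← key, hA.cfc_eq, hB.cfc_eq, IsHermitian.cfc, IsHermitian.cfc]
  simp only [Unitary.conjStarAlgAut_apply, overlap, star_eq_conjTranspose,
    conjTranspose_eq_transpose_of_trivial, transpose_mul, transpose_transpose]
  rw [Matrix.mul_assoc, Matrix.mul_assoc, trace_mul_comm]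
  simp only [Matrix.mul_assoc]
  rfl

lemma cfc_const_one_matrix (hA : A.IsHermitian) : cfc (fun _ : ℝ => (1 : ℝ)) A = 1 :=
  cfc_const_one ℝ A hA

lemma cfc_id_matrix (hA : A.IsHermitian) : cfc (fun x : ℝ => x) A = A :=
  cfc_id' ℝ A hA

lemma cfc_isHermitian (f : ℝ → ℝ) (A : Matrix n n ℝ) : (cfc f A).IsHermitian :=
  cfc_predicate f A

lemma continuousOn_spectrum (f : ℝ → ℝ) (A : Matrix n n ℝ) : ContinuousOn f (spectrum ℝ A) :=
  (finite_real_spectrum (𝕜 := ℝ)).continuousOn f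

lemma continuousOn_image_spectrum (f g : ℝ → ℝ) (A : Matrix n n ℝ) :
    ContinuousOn g (f '' spectrum ℝ A) :=
  ((finite_real_spectrum (𝕜 := ℝ)).image f).continuousOn g

lemma cfc_mul_matrix (f g : ℝ → ℝ) (A : Matrix n n ℝ) :
    cfc (fun x => f x * g x) A = cfc f A * cfc g A :=
  cfc_mul f g A (continuousOn_spectrum _ _) (continuousOn_spectrum _ _)

lemma cfc_comp_matrix (g f : ℝ → ℝ) (hA : A.IsHermitian) :
    cfc (fun x => g (f x)) A = cfc g (cfc f A) :=
  cfc_comp' g f A (continuousOn_image_spectrum _ _ _) (continuousOn_spectrum _ _) hA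

lemma trace_cfc (hA : A.IsHermitian) (f : ℝ → ℝ) :
    (cfc f A).trace = ∑ i, f (hA.eigenvalues i) := by
  rw [hA.cfc_eq, IsHermitian.cfc, Unitary.conjStarAlgAut_apply, trace_mul_comm, ← mul_assoc]
  simp [trace_diagonal]

lemma trace_fenchelYoung_eq_sum (hA : A.IsHermitian) (hB : B.IsHermitian) (f g : ℝ → ℝ) :
    (A * B).trace + (cfc f A).trace + (cfc g B).trace =
      ∑ i, ∑ j, overlap hA hB i j ^ 2 * (hA.eigenvalues i * hB.eigenvalues j
        + f (hA.eigenvalues i) + g (hB.eigenvalues j)) := by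
  have h1 := trace_cfc_mul_cfc hA hB (fun x => x) (fun x => x)
  have h2 := trace_cfc_mul_cfc hA hB f (fun _ => 1)
  have h3 := trace_cfc_mul_cfc hA hB (fun _ => 1) g
  rw [cfc_id_matrix hA, cfc_id_matrix hB] at h1
  rw [cfc_const_one_matrix hB, mul_one] at h2
  rw [cfc_const_one_matrix hA, one_mul] at h3
  rw [h1, h2, h3]
  simp only [← Finset.sum_add_distrib]
  refine Finset.sum_congr rfl fun i _ => Finset.sum_congr rfl fun j _ => ?_
  ring

lemma trace_fenchelYoung_nonneg (hA : A.IsHermitian) (hB : B.IsHermitian) {f g : ℝ → ℝ}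
    (h : ∀ i j, 0 ≤ hA.eigenvalues i * hB.eigenvalues j + f (hA.eigenvalues i)
      + g (hB.eigenvalues j)) :
    0 ≤ (A * B).trace + (cfc f A).trace + (cfc g B).trace := by
  rw [trace_fenchelYoung_eq_sum hA hB]
  exact Finset.sum_nonneg fun i _ => Finset.sum_nonneg fun j _ => mul_nonneg (sq_nonneg _) (h i j)

/-- Every weighted term must vanish, so eigenvectors that overlap have eigenvalues related by φ. The
squared Frobenius norm of A - φ(B) is a sum with the same weights, hence zero. -/
lemma eq_cfc_of_trace_fenchelYoung_nonpos (hA : A.IsHermitian) (hB : B.IsHermitian)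
    {f g φ : ℝ → ℝ}
    (h : ∀ i j, 0 ≤ hA.eigenvalues i * hB.eigenvalues j + f (hA.eigenvalues i)
      + g (hB.eigenvalues j))
    (hφ : ∀ i j, hA.eigenvalues i * hB.eigenvalues j + f (hA.eigenvalues i)
      + g (hB.eigenvalues j) = 0 → hA.eigenvalues i = φ (hB.eigenvalues j))
    (h0 : (A * B).trace + (cfc f A).trace + (cfc g B).trace ≤ 0) : A = cfc φ B := by
  rw [trace_fenchelYoung_eq_sum hA hB] at h0
  have hterm : ∀ i j, overlap hA hB i j ^ 2 * (hA.eigenvalues i * hB.eigenvalues j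
      + f (hA.eigenvalues i) + g (hB.eigenvalues j)) = 0 := by
    have hnn : ∀ i j, 0 ≤ overlap hA hB i j ^ 2 * (hA.eigenvalues i * hB.eigenvalues j
      + f (hA.eigenvalues i) + g (hB.eigenvalues j)) := fun i j => mul_nonneg (sq_nonneg _) (h i j)
    have h0' := le_antisymm h0 (Finset.sum_nonneg fun i _ => Finset.sum_nonneg fun j _ => hnn i j)
    intro i j
    have hi := (Finset.sum_eq_zero_iff_of_nonneg
      (fun i _ => Finset.sum_nonneg fun j _ => hnn i j)).1 h0' i (Finset.mem_univ i)
    exact (Finset.sum_eq_zero_iff_of_nonneg (fun j _ => hnn i j)).1 hi j (Finset.mem_univ j)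
  have hdiff : ((A - cfc φ B) * (A - cfc φ B)).trace = 0 := by
    have h1 := trace_cfc_mul_cfc hA hB (fun x => x) φ
    have h2 := trace_cfc_mul_cfc hA hB (fun x => x * x) (fun _ => 1)
    have h3 := trace_cfc_mul_cfc hA hB (fun _ => 1) (fun y => φ y * φ y)
    rw [cfc_id_matrix hA] at h1
    rw [cfc_const_one_matrix hB, mul_one, cfc_mul_matrix, cfc_id_matrix hA] at h2
    rw [cfc_const_one_matrix hA, one_mul, cfc_mul_matrix] at h3
    have h4 : ((A - cfc φ B) * (A - cfc φ B)).trace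
        = (A * A).trace - 2 * (A * cfc φ B).trace + (cfc φ B * cfc φ B).trace := by
      simp only [Matrix.sub_mul, Matrix.mul_sub, trace_sub]
      rw [trace_mul_comm (cfc φ B) A]
      ring
    rw [h4, h1, h2, h3]
    simp only [Finset.mul_sum, ← Finset.sum_sub_distrib, ← Finset.sum_add_distrib]
    refine Finset.sum_eq_zero fun i _ => Finset.sum_eq_zero fun j _ => ?_
    rcases mul_eq_zero.1 (hterm i j) with h5 | h5
    · rw [h5]; ring
    · rw [hφ i j h5]; ring
  have hherm : (A - cfc φ B)ᴴ = A - cfc φ B := hA.sub (cfc_isHermitian φ B)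
  nth_rewrite 1 [← hherm] at hdiff
  exact sub_eq_zero.1 (trace_conjTranspose_mul_self_eq_zero_iff.1 hdiff)

end FenchelYoung

/-! ### Trace inequalities for powers of products -/

section GoldenThompson

open Matrix

variable {n : Type*} [Fintype n]

/-- The squared Frobenius norms of A - Bᵀ and A + Bᵀ are nonnegative. -/
lemma abs_trace_mul_le {A B : Matrix n n ℝ} {c : ℝ} (hA : (A * Aᵀ).trace ≤ c)
    (hB : (B * Bᵀ).trace ≤ c) : |(A * B).trace| ≤ c := by
  have e1 : ((A - Bᵀ) * (A - Bᵀ)ᵀ).trace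
      = (A * Aᵀ).trace + (B * Bᵀ).trace - 2 * (A * B).trace := by
    simp only [transpose_sub, transpose_transpose, Matrix.sub_mul, Matrix.mul_sub, trace_sub]
    rw [trace_mul_comm Bᵀ B, ← trace_transpose (Bᵀ * Aᵀ), transpose_mul, transpose_transpose,
      transpose_transpose]
    ring
  have e2 : ((A + Bᵀ) * (A + Bᵀ)ᵀ).trace
      = (A * Aᵀ).trace + (B * Bᵀ).trace + 2 * (A * B).trace := by
    simp only [transpose_add, transpose_transpose, Matrix.add_mul, Matrix.mul_add, trace_add]
    rw [trace_mul_comm Bᵀ B, ← trace_transpose (Bᵀ * Aᵀ), transpose_mul, transpose_transpose,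
      transpose_transpose]
    ring
  have p1 : 0 ≤ ((A - Bᵀ) * (A - Bᵀ)ᵀ).trace :=
    (posSemidef_self_mul_conjTranspose (A - Bᵀ)).trace_nonneg
  have p2 : 0 ≤ ((A + Bᵀ) * (A + Bᵀ)ᵀ).trace :=
    (posSemidef_self_mul_conjTranspose (A + Bᵀ)).trace_nonneg
  rw [abs_le]
  constructor <;> linarith

variable [DecidableEq n]

lemma trace_mul_pow_comm (A B : Matrix n n ℝ) (m : ℕ) (hm : m ≠ 0) :
    ((A * B) ^ m).trace = ((B * A) ^ m).trace := by
  obtain ⟨m, rfl⟩ := Nat.exists_eq_succ_of_ne_zero hm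
  have h : ∀ k : ℕ, (A * B) ^ k * A = A * (B * A) ^ k := by
    intro k
    induction k with
    | zero => simp
    | succ k ih => rw [pow_succ', Matrix.mul_assoc, ih, pow_succ']; simp only [Matrix.mul_assoc]
  rw [Nat.succ_eq_add_one, pow_succ, ← Matrix.mul_assoc, h, trace_mul_comm, ← Matrix.mul_assoc,
    pow_succ']

lemma prod_range_two_mul (M : ℕ → Matrix n n ℝ) (k : ℕ) :
    ((List.range (2 * k)).map M).prod
      = ((List.range k).map fun i => M (2 * i) * M (2 * i + 1)).prod := by
  induction k with
  | zero => simp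
  | succ k ihk =>
    rw [show 2 * (k + 1) = 2 * k + 1 + 1 by ring]
    simp only [List.range_succ, List.map_append, List.prod_append, List.map_cons,
      List.map_nil, List.prod_singleton, Matrix.mul_assoc]
    rw [ihk]

lemma mul_pow_eq_prod_range (P Q : Matrix n n ℝ) (k : ℕ) :
    (P * Q) ^ k = ((List.range (2 * k)).map fun i => if Even i then P else Q).prod := by
  rw [prod_range_two_mul]
  simp [List.map_const']

/-- A Hölder inequality for traces of products of `2 ^ (m + 1)` real matrices. -/
lemma abs_trace_prod_le {c : ℝ} (m : ℕ) :
    ∀ M : ℕ → Matrix n n ℝ, (∀ i, ((M i * (M i)ᵀ) ^ 2 ^ m).trace ≤ c) →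
      |((List.range (2 ^ (m + 1))).map M).prod.trace| ≤ c := by
  induction m with
  | zero =>
    intro M hM
    have := abs_trace_mul_le (A := M 0) (B := M 1) (c := c) (by simpa using hM 0)
      (by simpa using hM 1)
    simpa [List.range_succ] using this
  | succ m ih =>
    intro M hM
    -- Pairing neighbours halves the number of factors. The induction hypothesis serves twice: for
    -- the product of pairs, and then to bound each pair.
    rw [pow_succ 2 (m + 1), mul_comm, prod_range_two_mul]
    refine ih _ fun i => ?_
    set X := M (2 * i) with hX
    set Y := M (2 * i + 1) with hY
    have hXc : (((Xᵀ * X) * (Xᵀ * X)ᵀ) ^ 2 ^ m).trace ≤ c := by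
      rw [transpose_mul, transpose_transpose, ← pow_two, ← pow_mul, ← pow_succ',
        trace_mul_pow_comm _ _ _ (by positivity)]
      exact hM _
    have hYc : (((Y * Yᵀ) * (Y * Yᵀ)ᵀ) ^ 2 ^ m).trace ≤ c := by
      rw [transpose_mul, transpose_transpose, ← pow_two, ← pow_mul, ← pow_succ']
      exact hM _
    have h1 : ((X * Y * (X * Y)ᵀ) ^ 2 ^ m).trace = (((Xᵀ * X) * (Y * Yᵀ)) ^ 2 ^ m).trace := by
      rw [transpose_mul, Matrix.mul_assoc, trace_mul_pow_comm _ _ _ (by positivity)]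
      rw [show Y * (Yᵀ * Xᵀ) * X = (Y * Yᵀ) * (Xᵀ * X) by simp only [Matrix.mul_assoc]]
      rw [trace_mul_pow_comm _ _ _ (by positivity)]
    -- The power is an alternating product of 2^(m+1) factors XᵀX and YYᵀ.
    rw [h1, mul_pow_eq_prod_range, ← pow_succ']
    refine (le_abs_self _).trans (ih _ fun j => ?_)
    split_ifs
    · exact hXc
    · exact hYc

/-- Hölder with all factors equal to XY replaces (XY)^(2^(m+1)) by (X²Y²)^(2^m); the induction
continues with X² and Y². -/
lemma trace_mul_pow_le (m : ℕ) : ∀ {X Y : Matrix n n ℝ}, X.IsSymm → Y.IsSymm →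
    ((X * Y) ^ 2 ^ m).trace ≤ (X ^ 2 ^ m * Y ^ 2 ^ m).trace := by
  induction m with
  | zero => intro X Y _ _; simp
  | succ m ih =>
    intro X Y hX hY
    have h1 := abs_trace_prod_le m (fun _ => X * Y) (fun _ => le_refl _)
    have h2 : ((X * Y * (X * Y)ᵀ) ^ 2 ^ m).trace = ((X ^ 2 * Y ^ 2) ^ 2 ^ m).trace := by
      rw [transpose_mul, hX.eq, hY.eq, Matrix.mul_assoc, trace_mul_pow_comm _ _ _ (by positivity),
        show Y * (Y * X) * X = Y ^ 2 * X ^ 2 by simp only [pow_two, Matrix.mul_assoc],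
        trace_mul_pow_comm _ _ _ (by positivity)]
    have h3 := ih (hX.pow 2) (hY.pow 2)
    rw [List.map_const', List.length_range, List.prod_replicate, h2] at h1
    rw [← pow_mul, ← pow_mul, ← pow_succ'] at h3
    exact (le_abs_self _).trans (h1.trans h3)

end GoldenThompson

/-! ### The Lie product formula -/

section LieProduct

open Filter Topology NormedSpace

variable {𝔸 : Type*} [NormedRing 𝔸] [NormOneClass 𝔸]

lemma norm_pow_sub_pow_le {P Q : 𝔸} {M : ℝ} (hP : ‖P‖ ≤ M) (hQ : ‖Q‖ ≤ M) (hM : 1 ≤ M) (k : ℕ) :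
    ‖P ^ k - Q ^ k‖ ≤ k * M ^ k * ‖P - Q‖ := by
  induction k with
  | zero => simp
  | succ k ih =>
    have h : P ^ (k + 1) - Q ^ (k + 1) = P ^ k * (P - Q) + (P ^ k - Q ^ k) * Q := by
      rw [pow_succ, pow_succ]; noncomm_ring
    have hMk : M ^ k ≤ M ^ (k + 1) := pow_le_pow_right₀ hM (Nat.le_succ k)
    have h1 : ‖P ^ k * (P - Q)‖ ≤ M ^ (k + 1) * ‖P - Q‖ := by
      refine (norm_mul_le _ _).trans ?_
      gcongr
      exact (norm_pow_le P k).trans ((pow_le_pow_left₀ (norm_nonneg _) hP k).trans hMk)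
    have h2 : ‖(P ^ k - Q ^ k) * Q‖ ≤ k * M ^ k * ‖P - Q‖ * M :=
      (norm_mul_le _ _).trans (mul_le_mul ih hQ (norm_nonneg _) (by positivity))
    calc ‖P ^ (k + 1) - Q ^ (k + 1)‖ ≤ M ^ (k + 1) * ‖P - Q‖ + k * M ^ k * ‖P - Q‖ * M := by
          rw [h]; exact (norm_add_le _ _).trans (add_le_add h1 h2)
      _ = ((k + 1 : ℕ) : ℝ) * M ^ (k + 1) * ‖P - Q‖ := by push_cast; ring

variable [NormedAlgebra ℝ 𝔸]

lemma norm_normedSpace_exp_le (x : 𝔸) : ‖exp x‖ ≤ Real.exp ‖x‖ := by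
  have hs := Real.summable_pow_div_factorial ‖x‖
  rw [exp_eq_tsum ℝ, Real.exp_eq_exp_ℝ, exp_eq_tsum_div]
  refine tsum_of_norm_bounded hs.hasSum fun i => ?_
  rw [norm_smul, norm_inv, Real.norm_natCast, div_eq_inv_mul]
  gcongr
  exact norm_pow_le x i

variable [CompleteSpace 𝔸]

/-- The Lie product formula. -/
lemma tendsto_exp_mul_exp_pow (X Y : 𝔸) :
    Tendsto (fun N : ℕ => (exp ((N : ℝ)⁻¹ • X) * exp ((N : ℝ)⁻¹ • Y)) ^ N) atTop
      (𝓝 (exp (X + Y))) := by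
  set C := ‖X‖ + ‖Y‖ with hC
  -- D vanishes to first order at 0. The N-th powers differ by at most N e^C ‖D(1/N)‖, which is e^C
  -- times the norm of a difference quotient of D, so it tends to 0.
  set D : ℝ → 𝔸 := fun s => exp (s • X) * exp (s • Y) - exp (s • (X + Y)) with hD
  have hder : HasDerivAt D 0 0 := by
    have h : HasDerivAt D _ 0 := ((hasDerivAt_exp_smul_const (𝕂 := ℝ) X 0).mul
      (hasDerivAt_exp_smul_const (𝕂 := ℝ) Y 0)).sub
      (hasDerivAt_exp_smul_const (𝕂 := ℝ) (X + Y) 0)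
    convert h using 1
    simp
  have hinv : Tendsto (fun N : ℕ => (N : ℝ)⁻¹) atTop (𝓝[≠] 0) := by
    refine tendsto_nhdsWithin_iff.2 ⟨tendsto_inv_atTop_nhds_zero_nat, ?_⟩
    filter_upwards [eventually_gt_atTop 0] with N hN
    simp [hN.ne']
  have hslope : Tendsto (fun N : ℕ => Real.exp C * ‖slope D 0 (N : ℝ)⁻¹‖) atTop (𝓝 0) := by
    have h := ((hasDerivAt_iff_tendsto_slope.1 hder).comp hinv).norm.const_mul (Real.exp C)
    simpa using h
  refine tendsto_iff_norm_sub_tendsto_zero.2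
    (squeeze_zero' (Eventually.of_forall fun _ => norm_nonneg _) ?_ hslope)
  filter_upwards [eventually_gt_atTop 0] with N hN
  have hN' : (0 : ℝ) < N := Nat.cast_pos.2 hN
  have hCpos : 0 ≤ C := by positivity
  have hQN : exp ((N : ℝ)⁻¹ • (X + Y)) ^ N = exp (X + Y) := by
    let _ : NormedAlgebra ℚ 𝔸 := NormedAlgebra.restrictScalars ℚ ℝ 𝔸
    rw [← NormedSpace.exp_nsmul, ← Nat.cast_smul_eq_nsmul ℝ, smul_smul, mul_inv_cancel₀ hN'.ne',
      one_smul]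
  have hnorm : ∀ Z : 𝔸, ‖(N : ℝ)⁻¹ • Z‖ = (N : ℝ)⁻¹ * ‖Z‖ := fun Z => by
    rw [norm_smul, norm_inv, Real.norm_natCast]
  have hP : ‖exp ((N : ℝ)⁻¹ • X) * exp ((N : ℝ)⁻¹ • Y)‖ ≤ Real.exp ((N : ℝ)⁻¹ * C) := by
    rw [hC, mul_add, Real.exp_add, ← hnorm, ← hnorm]
    exact (norm_mul_le _ _).trans (mul_le_mul (norm_normedSpace_exp_le _)
      (norm_normedSpace_exp_le _) (norm_nonneg _) (Real.exp_pos _).le)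
  have hQ : ‖exp ((N : ℝ)⁻¹ • (X + Y))‖ ≤ Real.exp ((N : ℝ)⁻¹ * C) := by
    refine (norm_normedSpace_exp_le _).trans (Real.exp_le_exp.2 ?_)
    rw [hnorm]
    gcongr
    exact norm_add_le X Y
  have hmain := norm_pow_sub_pow_le hP hQ (Real.one_le_exp (by positivity)) N
  rw [hQN, ← Real.exp_nat_mul, mul_inv_cancel_left₀ hN'.ne'] at hmain
  refine hmain.trans (le_of_eq ?_)
  have hD0 : D 0 = 0 := by simp [hD]
  rw [slope_def_module, hD0, sub_zero, sub_zero, inv_inv, norm_smul, Real.norm_natCast]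
  ring

end LieProduct

/-! ### The Golden–Thompson inequality -/

section GoldenThompson

open Matrix Filter Topology NormedSpace

variable {n : Type*} [Fintype n] [DecidableEq n]

open scoped Matrix.Norms.Operator in
/-- The Lie product formula for real matrices. -/
lemma tendsto_matrix_exp_mul_exp_pow [Nonempty n] (X Y : Matrix n n ℝ) :
    Tendsto (fun N : ℕ => (exp ((N : ℝ)⁻¹ • X) * exp ((N : ℝ)⁻¹ • Y)) ^ N) atTop
      (𝓝 (exp (X + Y))) :=
  tendsto_exp_mul_exp_pow X Y

/-- The Golden–Thompson inequality for real symmetric matrices. -/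
theorem trace_exp_add_le {X Y : Matrix n n ℝ} (hX : X.IsSymm) (hY : Y.IsSymm) :
    (exp (X + Y)).trace ≤ (exp X * exp Y).trace := by
  cases isEmpty_or_nonempty n
  · simp [trace]
  -- Only N = 2^m is used, where `trace_mul_pow_le` applies.
  have hlim := (tendsto_matrix_exp_mul_exp_pow X Y).comp
    (tendsto_pow_atTop_atTop_of_one_lt (one_lt_two : 1 < 2))
  have htr : Continuous (trace : Matrix n n ℝ → ℝ) := Continuous.matrix_trace continuous_id
  refine le_of_tendsto ((htr.tendsto _).comp hlim) (Eventually.of_forall fun m => ?_)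
  have hne : ((2 ^ m : ℕ) : ℝ) ≠ 0 := by positivity
  have hpow : ∀ Z : Matrix n n ℝ, exp (((2 ^ m : ℕ) : ℝ)⁻¹ • Z) ^ 2 ^ m = exp Z := fun Z => by
    rw [← Matrix.exp_nsmul, ← Nat.cast_smul_eq_nsmul ℝ, smul_smul, mul_inv_cancel₀ hne, one_smul]
  have h := trace_mul_pow_le m (hX.smul (((2 ^ m : ℕ) : ℝ)⁻¹)).exp
    (hY.smul (((2 ^ m : ℕ) : ℝ)⁻¹)).exp
  rw [hpow, hpow] at h
  exact h

end GoldenThompson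

/-! ### Spectral shifts and Fenchel pairs on matrices -/

section

open Matrix

variable {n : Type*} [Fintype n] [DecidableEq n] {A B H : Matrix n n ℝ}

lemma cfc_add_const_eq (hH : H.IsHermitian) (l : ℝ) : cfc (fun x => x + l) H = H + l • 1 := by
  have h : cfc (fun x => x + l) H = _ :=
    cfc_add_const l (fun x => x) H (continuousOn_spectrum _ _) hH
  rw [h, cfc_id_matrix hH, Algebra.algebraMap_eq_smul_one]

lemma trace_cfc_add_smul_one (hH : H.IsHermitian) (φ : ℝ → ℝ) (l : ℝ) :
    (cfc φ (H + l • 1)).trace = ∑ i, φ (hH.eigenvalues i + l) := by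
  rw [← cfc_add_const_eq hH, ← cfc_comp_matrix φ _ hH, trace_cfc hH]

/-- A scalar function `f` with its Fenchel dual: `g` is `y ↦ sup_x (-x y - f x)` over `x ≥ 0`,
attained only at `φ y`. -/
structure FenchelPair (f g φ : ℝ → ℝ) (D : Set ℝ) : Prop where
  nonneg : ∀ x y, 0 ≤ x → y ∈ D → 0 ≤ x * y + f x + g y
  eq_of_eq_zero : ∀ x y, 0 ≤ x → y ∈ D → x * y + f x + g y = 0 → x = φ y
  value : ∀ y ∈ D, φ y * y + f (φ y) + g y = 0
  dual_nonneg : ∀ y ∈ D, 0 ≤ φ y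

namespace FenchelPair

variable {f g φ : ℝ → ℝ} {D : Set ℝ}

lemma trace_nonneg (P : FenchelPair f g φ D) (hA : A.PosSemidef) (hB : B.IsHermitian)
    (hD : ∀ i, hB.eigenvalues i ∈ D) :
    0 ≤ (A * B).trace + (cfc f A).trace + (cfc g B).trace :=
  trace_fenchelYoung_nonneg hA.isHermitian hB fun i j =>
    P.nonneg _ _ (hA.eigenvalues_nonneg i) (hD j)

lemma eq_cfc (P : FenchelPair f g φ D) (hA : A.PosSemidef) (hB : B.IsHermitian)
    (hD : ∀ i, hB.eigenvalues i ∈ D)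
    (h0 : (A * B).trace + (cfc f A).trace + (cfc g B).trace ≤ 0) : A = cfc φ B :=
  eq_cfc_of_trace_fenchelYoung_nonpos hA.isHermitian hB
    (fun i j => P.nonneg _ _ (hA.eigenvalues_nonneg i) (hD j))
    (fun i j => P.eq_of_eq_zero _ _ (hA.eigenvalues_nonneg i) (hD j)) h0

lemma trace_cfc_eq (P : FenchelPair f g φ D) (hB : B.IsHermitian)
    (hD : ∀ i, hB.eigenvalues i ∈ D) :
    (cfc φ B * B).trace + (cfc f (cfc φ B)).trace + (cfc g B).trace = 0 := by
  have h1 : cfc φ B * B = cfc (fun y => φ y * y) B := by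
    rw [cfc_mul_matrix, cfc_id_matrix hB]
  rw [h1, ← cfc_comp_matrix f φ hB, trace_cfc hB, trace_cfc hB, trace_cfc hB,
    ← Finset.sum_add_distrib, ← Finset.sum_add_distrib]
  exact Finset.sum_eq_zero fun i _ => P.value _ (hD i)

lemma posSemidef_cfc (P : FenchelPair f g φ D) (hB : B.IsHermitian)
    (hD : ∀ i, hB.eigenvalues i ∈ D) : (cfc φ B).PosSemidef := by
  rw [hB.cfc_eq, IsHermitian.cfc, Unitary.conjStarAlgAut_apply]
  exact (PosSemidef.diagonal fun i => P.dual_nonneg _ (hD i)).mul_mul_conjTranspose_same _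

end FenchelPair

end

/-! ### Minimizers, one-round growth and telescoping -/

open Matrix

variable {d : ℕ}

lemma ip_eq_trace_mul {A B : Matrix (Fin d) (Fin d) ℝ} (hA : A.PosSemidef) :
    ip A B = (A * B).trace := by
  have h : Aᵀ = A := hA.isHermitian
  rw [ip, h]

/-- A minimizer of `⟨·, H⟩ + w` over the spectraplex is the dual function of a shift of `H`. -/
lemma FenchelPair.minimizer {f g φ : ℝ → ℝ} {D : Set ℝ} (P : FenchelPair f g φ D)
    {H A : Matrix (Fin d) (Fin d) ℝ} {l : ℝ} (hA : A ∈ spectraplex d)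
    (hK : (H + l • 1).IsHermitian) (hD : ∀ i, hK.eigenvalues i ∈ D)
    (htr : (cfc φ (H + l • 1)).trace = 1)
    (hmin : ∀ B ∈ spectraplex d,
      (A * H).trace + (cfc f A).trace ≤ (B * H).trace + (cfc f B).trace) :
    A = cfc φ (H + l • 1) := by
  have hG := hmin _ ⟨P.posSemidef_cfc hK hD, htr⟩
  have hv := P.trace_cfc_eq hK hD
  refine P.eq_cfc hA.1 hK hD ?_
  -- On trace-one matrices the shift only adds the constant l, so A does as well as φ(H + l), which
  -- attains Fenchel–Young equality.
  have hs : ∀ B : Matrix (Fin d) (Fin d) ℝ, B.trace = 1 →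
      (B * (H + l • 1)).trace = (B * H).trace + l := fun B hB => by
    rw [Matrix.mul_add, trace_add, Matrix.mul_smul, Matrix.mul_one, trace_smul, hB, smul_eq_mul,
      mul_one]
  rw [hs _ htr] at hv
  rw [hs _ hA.2]
  linarith

/-- The one-round growth of the optimal value of the regularized problem. -/
lemma FenchelPair.step {f g φ : ℝ → ℝ} {D : Set ℝ} (P : FenchelPair f g φ D)
    {H A B E : Matrix (Fin d) (Fin d) ℝ} {l : ℝ} (hA : A ∈ spectraplex d) (hB : B ∈ spectraplex d)
    (hK : (H + l • 1).IsHermitian) (hD : ∀ i, hK.eigenvalues i ∈ D)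
    (hAK : A = cfc φ (H + l • 1))
    (hK' : (H + l • 1 + E).IsHermitian) (hD' : ∀ i, hK'.eigenvalues i ∈ D) :
    (A * H).trace + (cfc f A).trace
        + ((cfc g (H + l • 1)).trace - (cfc g (H + l • 1 + E)).trace) ≤
      (B * H).trace + (cfc f B).trace + (B * E).trace := by
  have h1 := P.trace_cfc_eq hK hD
  -- The old multiplier l is kept for the new loss; weak duality needs no optimal one.
  have h2 := P.trace_nonneg hB.1 hK' hD'
  rw [← hAK] at h1
  simp only [Matrix.mul_add, trace_add, Matrix.mul_smul, trace_smul, hA.2, hB.2,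
    smul_eq_mul, mul_one] at h1 h2
  linarith

/-- Regret telescopes along per-round lower bounds `b t` on the growth of the optimal value. -/
lemma regret_le_of_step {k : ℕ} {w : Matrix (Fin d) (Fin d) ℝ → ℝ} {α m M : ℝ} (hα : 0 < α)
    (hne : (spectraplex d).Nonempty)
    {A F : Fin k → Matrix (Fin d) (Fin d) ℝ} (b : Fin k → ℝ)
    (hA : ∀ t, A t ∈ spectraplex d)
    (hm : ∀ B ∈ spectraplex d, m ≤ w B) (hM : ∀ B ∈ spectraplex d, w B ≤ M)
    (hstep : ∀ t, ∀ B ∈ spectraplex d,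
      α * ∑ s ∈ Finset.Iio t, ip (A t) (F s) + w (A t) + b t ≤
        α * ∑ s ∈ Finset.Iio t, ip B (F s) + w B + α * ip B (F t)) :
    regret A F ≤ (M - m) / α + ∑ t, ip (A t) (F t) - 1 / α * ∑ t, b t := by
  have key : ∀ j : ℕ, j ≤ k → ∀ B ∈ spectraplex d,
      m + ∑ s : Fin k with s.val < j, b s ≤ α * ∑ s : Fin k with s.val < j, ip B (F s) + w B := by
    intro j
    induction j with
    | zero => intro _ B hB; simpa using hm B hB
    | succ j ih =>
      intro hj B hB
      have hset : (Finset.univ.filter fun s : Fin k => s.val < j + 1)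
          = insert ⟨j, hj⟩ (Finset.univ.filter fun s : Fin k => s.val < j) := by
        ext s
        simp only [Finset.mem_filter, Finset.mem_univ, true_and, Finset.mem_insert, Fin.ext_iff]
        omega
      have hIio : (Finset.univ.filter fun s : Fin k => s.val < j) = Finset.Iio ⟨j, hj⟩ := by
        ext s
        simp [Fin.lt_def]
      -- The hypothesis is applied to the leader of this round, and `hstep` passes from it to B.
      have h1 := ih (by omega) _ (hA ⟨j, hj⟩)
      have h2 := hstep ⟨j, hj⟩ B hB
      rw [hset, Finset.sum_insert (by simp), Finset.sum_insert (by simp)]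
      rw [hIio] at h1 ⊢
      linarith
  have hall : ∀ B ∈ spectraplex d, (∑ t, b t - (M - m)) / α ≤ ip B (∑ t, F t) := by
    intro B hB
    have h := key k le_rfl B hB
    simp only [Fin.is_lt, Finset.filter_true] at h
    have hsum : ip B (∑ t, F t) = ∑ t, ip B (F t) := by
      simp only [ip, Matrix.mul_sum, trace_sum]
    rw [hsum, div_le_iff₀ hα]
    have := hM B hB
    linarith
  have hinf : (∑ t, b t - (M - m)) / α ≤ sInf ((fun U => ip U (∑ t, F t)) '' spectraplex d) := by
    refine le_csInf (hne.image _) ?_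
    rintro _ ⟨B, hB, rfl⟩
    exact hall B hB
  have hexp : (∑ t, b t - (M - m)) / α = 1 / α * ∑ t, b t - (M - m) / α := by
    field_simp
  rw [regret]
  linarith

lemma spectraplex_nonempty (hd : 1 ≤ d) : (spectraplex d).Nonempty := by
  refine ⟨(d : ℝ)⁻¹ • 1, PosSemidef.one.smul (by positivity), ?_⟩
  have : (d : ℝ) ≠ 0 := by positivity
  simp [trace_smul, this]

/-! ### The two Fenchel pairs and the ranges of the regularizers -/

open Matrix

variable {d : ℕ}

/-- For x > 0 this is x times e^u ≥ 1 + u at u = -(y + log x), strict unless u = 0. At x = 0 only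
e^(-y) > 0 remains. -/
lemma fenchelPair_entropy :
    FenchelPair (fun x => x * (Real.log x - 1)) (fun y => Real.exp (-y)) (fun y => Real.exp (-y))
      Set.univ where
  nonneg x y hx _ := by
    rcases hx.eq_or_lt with rfl | hx
    · simpa using (Real.exp_pos _).le
    · have h := Real.add_one_le_exp (-(y + Real.log x))
      have e : Real.exp (-y) = x * Real.exp (-(y + Real.log x)) := by
        rw [neg_add, Real.exp_add, Real.exp_neg (Real.log x), Real.exp_log hx]
        field_simp
      rw [e]
      nlinarith
  eq_of_eq_zero x y hx _ h0 := by
    rcases hx.eq_or_lt with rfl | hx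
    · have := Real.exp_pos (-y)
      simp at h0
    · have e : Real.exp (-y) = x * Real.exp (-(y + Real.log x)) := by
        rw [neg_add, Real.exp_add, Real.exp_neg (Real.log x), Real.exp_log hx]
        field_simp
      by_cases hz : -(y + Real.log x) = 0
      · rw [e, hz, Real.exp_zero, mul_one]
      · have h := Real.add_one_lt_exp hz
        rw [e] at h0
        nlinarith
  value y _ := by
    simp only [Real.log_exp]
    ring
  dual_nonneg y _ := (Real.exp_pos _).le

/-- The gap is a perfect square, (√x y - 1)²/y. -/
lemma fenchelPair_half :
    FenchelPair (fun x => -2 * Real.sqrt x) (fun y => y⁻¹) (fun y => (y ^ 2)⁻¹) (Set.Ioi 0) where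
  nonneg x y hx hy := by
    have hy : 0 < y := hy
    have e : x * y + -2 * Real.sqrt x + y⁻¹ = (Real.sqrt x * y - 1) ^ 2 * y⁻¹ := by
      nth_rewrite 1 [← Real.sq_sqrt hx]
      field_simp
      ring
    rw [e]
    positivity
  eq_of_eq_zero x y hx hy h0 := by
    have hy : 0 < y := hy
    have e : x * y + -2 * Real.sqrt x + y⁻¹ = (Real.sqrt x * y - 1) ^ 2 * y⁻¹ := by
      nth_rewrite 1 [← Real.sq_sqrt hx]
      field_simp
      ring
    rw [e] at h0
    have h1 : Real.sqrt x * y - 1 = 0 := by simpa [hy.ne'] using h0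
    refine eq_inv_of_mul_eq_one_left ?_
    rw [← Real.sq_sqrt hx, ← mul_pow, sub_eq_zero.1 h1, one_pow]
  value y hy := by
    have hy : 0 < y := hy
    simp only [Real.sqrt_inv, Real.sqrt_sq hy.le]
    field_simp
    ring
  dual_nonneg y _ := by positivity

lemma entropyReg_eq_trace_cfc {A : Matrix (Fin d) (Fin d) ℝ} (hA : A.PosSemidef) :
    entropyReg A = (cfc (fun x => x * (Real.log x - 1)) A).trace := by
  have h : cfc (fun x => Real.log x - 1) A = matLog A - 1 := by
    have h' : cfc (fun x => Real.log x - 1) A = _ :=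
      cfc_sub Real.log (fun _ => 1) A (continuousOn_spectrum _ _) (continuousOn_spectrum _ _)
    rw [h', cfc_const_one_matrix hA.isHermitian, matLog]
  rw [cfc_mul_matrix, cfc_id_matrix hA.isHermitian, h, entropyReg, ip_eq_trace_mul hA]

lemma halfReg_eq_trace_cfc {A : Matrix (Fin d) (Fin d) ℝ} (hA : A.PosSemidef) :
    halfReg A = (cfc (fun x => -2 * Real.sqrt x) A).trace := by
  rw [halfReg, matSqrt, trace_cfc hA.isHermitian, trace_cfc hA.isHermitian, Finset.mul_sum]

lemma sum_eigenvalues_eq_trace {A : Matrix (Fin d) (Fin d) ℝ} (hA : A.IsHermitian) :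
    ∑ i, hA.eigenvalues i = A.trace := by
  rw [← trace_cfc hA (fun x => x), cfc_id_matrix hA]

/-- Fenchel–Young against l times the identity. The later choices l = log d and l = √d satisfy φ(l)
= 1/d, the eigenvalue of the uniform matrix. -/
lemma FenchelPair.le_trace_cfc {f g φ : ℝ → ℝ} {D : Set ℝ} (P : FenchelPair f g φ D) {l : ℝ}
    (hl : l ∈ D) {A : Matrix (Fin d) (Fin d) ℝ} (hA : A ∈ spectraplex d) :
    -(l + d * g l) ≤ (cfc f A).trace := by
  obtain ⟨hP, htr⟩ := hA
  have h : 0 ≤ ∑ i, (hP.isHermitian.eigenvalues i * l + f (hP.isHermitian.eigenvalues i)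
      + g l) := Finset.sum_nonneg fun i _ => P.nonneg _ _ (hP.eigenvalues_nonneg i) hl
  rw [Finset.sum_add_distrib, Finset.sum_add_distrib, ← Finset.sum_mul,
    sum_eigenvalues_eq_trace, htr, ← trace_cfc] at h
  simp only [Finset.sum_const, Finset.card_univ, Fintype.card_fin, nsmul_eq_mul] at h
  linarith

lemma eigenvalues_le_trace {A : Matrix (Fin d) (Fin d) ℝ} (hA : A.PosSemidef) (i : Fin d) :
    hA.isHermitian.eigenvalues i ≤ A.trace := by
  rw [← sum_eigenvalues_eq_trace hA.isHermitian]
  exact Finset.single_le_sum (fun j _ => hA.eigenvalues_nonneg j) (Finset.mem_univ i)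

lemma entropyReg_le {A : Matrix (Fin d) (Fin d) ℝ} (hA : A ∈ spectraplex d) :
    entropyReg A ≤ -1 := by
  obtain ⟨hP, htr⟩ := hA
  have hneg : -1 = ∑ i, -hP.isHermitian.eigenvalues i := by
    rw [Finset.sum_neg_distrib, sum_eigenvalues_eq_trace hP.isHermitian, htr]
  rw [entropyReg_eq_trace_cfc hP, trace_cfc hP.isHermitian, hneg]
  refine Finset.sum_le_sum fun i _ => ?_
  have h0 := hP.eigenvalues_nonneg i
  have h1 := Real.log_nonpos h0 ((eigenvalues_le_trace hP i).trans_eq htr)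
  nlinarith

lemma neg_log_sub_one_le_entropyReg (hd : 1 ≤ d) {A : Matrix (Fin d) (Fin d) ℝ}
    (hA : A ∈ spectraplex d) : -Real.log d - 1 ≤ entropyReg A := by
  have h := fenchelPair_entropy.le_trace_cfc (l := Real.log d) (Set.mem_univ _) hA
  have hd' : (0 : ℝ) < d := by exact_mod_cast hd
  rw [Real.exp_neg, Real.exp_log hd', mul_inv_cancel₀ hd'.ne', ← entropyReg_eq_trace_cfc hA.1] at h
  linarith

lemma halfReg_nonpos {A : Matrix (Fin d) (Fin d) ℝ} (hA : A ∈ spectraplex d) :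
    halfReg A ≤ 0 := by
  rw [halfReg_eq_trace_cfc hA.1, trace_cfc hA.1.isHermitian]
  refine Finset.sum_nonpos fun i _ => ?_
  have := Real.sqrt_nonneg (hA.1.isHermitian.eigenvalues i)
  linarith

lemma neg_two_mul_sqrt_le_halfReg (hd : 1 ≤ d) {A : Matrix (Fin d) (Fin d) ℝ}
    (hA : A ∈ spectraplex d) : -(2 * Real.sqrt d) ≤ halfReg A := by
  have hd' : (0 : ℝ) < d := by exact_mod_cast hd
  have hs : 0 < Real.sqrt d := Real.sqrt_pos.2 hd'
  have h := fenchelPair_half.le_trace_cfc (l := Real.sqrt d) hs hA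
  rw [← halfReg_eq_trace_cfc hA.1] at h
  have e : (d : ℝ) * (Real.sqrt d)⁻¹ = Real.sqrt d := by
    rw [← div_eq_mul_inv, Real.div_sqrt]
  rw [e] at h
  linarith

/-! ### Multipliers normalizing the trace -/

lemma exists_shift_entropy (hd : 1 ≤ d) (h : Fin d → ℝ) :
    ∃ l : ℝ, ∑ i, Real.exp (-(h i + l)) = 1 := by
  have : Nonempty (Fin d) := ⟨⟨0, hd⟩⟩
  have hZ : 0 < ∑ i, Real.exp (-h i) :=
    Finset.sum_pos (fun i _ => Real.exp_pos _) Finset.univ_nonempty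
  refine ⟨Real.log (∑ i, Real.exp (-h i)), ?_⟩
  simp only [neg_add, Real.exp_add, Real.exp_neg (Real.log _), Real.exp_log hZ]
  rw [← Finset.sum_mul, mul_inv_cancel₀ hZ.ne']

/-- Intermediate values: with the least h i shifted to 1, its term alone is 1; with it shifted to
√d, every term is at most 1/d. -/
lemma exists_shift_half (hd : 1 ≤ d) (h : Fin d → ℝ) :
    ∃ l : ℝ, (∀ i, 0 < h i + l) ∧ ∑ i, ((h i + l) ^ 2)⁻¹ = 1 := by
  have : Nonempty (Fin d) := ⟨⟨0, hd⟩⟩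
  obtain ⟨i₀, hi₀⟩ := Finite.exists_min h
  have hd' : (1 : ℝ) ≤ d := by exact_mod_cast hd
  have hs : 1 ≤ Real.sqrt d := Real.one_le_sqrt.2 hd'
  have hpos : ∀ l ∈ Set.Icc (1 - h i₀) (Real.sqrt d - h i₀), ∀ i, 0 < h i + l := fun l hl i => by
    have := hi₀ i
    have := hl.1
    linarith
  have hcont : ContinuousOn (fun l => ∑ i, ((h i + l) ^ 2)⁻¹)
      (Set.Icc (1 - h i₀) (Real.sqrt d - h i₀)) := by
    refine continuousOn_finsetSum _ fun i _ => ContinuousOn.inv₀ (by fun_prop) fun l hl => ?_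
    have := hpos l hl i
    positivity
  have hleft : 1 ≤ ∑ i, ((h i + (1 - h i₀)) ^ 2)⁻¹ := by
    have h1 : ((h i₀ + (1 - h i₀)) ^ 2)⁻¹ = 1 := by norm_num
    have h2 := Finset.single_le_sum (f := fun i => ((h i + (1 - h i₀)) ^ 2)⁻¹)
      (fun i _ => by positivity) (Finset.mem_univ i₀)
    simp only [h1] at h2
    exact h2
  have hright : ∑ i, ((h i + (Real.sqrt d - h i₀)) ^ 2)⁻¹ ≤ 1 := by
    have hterm : ∀ i ∈ Finset.univ, ((h i + (Real.sqrt d - h i₀)) ^ 2)⁻¹ ≤ (d : ℝ)⁻¹ := by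
      intro i _
      refine inv_anti₀ (by positivity) ?_
      rw [← Real.sq_sqrt (by positivity : (0 : ℝ) ≤ d)]
      have := hi₀ i
      rw [Real.sqrt_sq (by positivity)]
      exact pow_le_pow_left₀ (by positivity) (by linarith) 2
    refine (Finset.sum_le_sum hterm).trans ?_
    simp [mul_inv_cancel₀ (by positivity : (d : ℝ) ≠ 0)]
  obtain ⟨l, hl, hl'⟩ := intermediate_value_Icc' (by linarith) hcont ⟨hright, hleft⟩
  exact ⟨l, hpos l hl, hl'⟩

/-! ### Exponential, inverse and square root in the functional calculus -/

open scoped Matrix.Norms.L2Operator in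
lemma cfc_exp_eq {A : Matrix (Fin d) (Fin d) ℝ} (hA : A.IsHermitian) :
    cfc Real.exp A = NormedSpace.exp A :=
  CFC.real_exp_eq_normedSpace_exp hA

lemma cfc_exp_neg {A : Matrix (Fin d) (Fin d) ℝ} (hA : A.IsHermitian) :
    cfc (fun y => Real.exp (-y)) A = NormedSpace.exp (-A) := by
  have hneg : cfc (fun y : ℝ => -y) A = -A := by
    have h : cfc (fun y : ℝ => -y) A = _ := cfc_neg (fun y : ℝ => y) A
    rw [h, cfc_id_matrix hA]
  rw [cfc_comp_matrix Real.exp _ hA, hneg]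
  exact cfc_exp_eq hA.neg

lemma cfc_inv_eq {A : Matrix (Fin d) (Fin d) ℝ} (hA : A.PosDef) :
    cfc (fun y : ℝ => y⁻¹) A = A⁻¹ := by
  refine (inv_eq_right_inv ?_).symm
  nth_rewrite 1 [← cfc_id_matrix hA.isHermitian]
  rw [← cfc_mul_matrix, ← cfc_const_one_matrix hA.isHermitian]
  refine cfc_congr fun x hx => ?_
  rw [hA.isHermitian.spectrum_real_eq_range_eigenvalues] at hx
  obtain ⟨i, rfl⟩ := hx
  exact mul_inv_cancel₀ (hA.eigenvalues_pos i).ne'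

lemma matSqrt_cfc_inv_sq {A : Matrix (Fin d) (Fin d) ℝ} (hA : A.PosDef) :
    matSqrt (cfc (fun y : ℝ => (y ^ 2)⁻¹) A) = A⁻¹ := by
  rw [matSqrt, ← cfc_comp_matrix _ _ hA.isHermitian, ← cfc_inv_eq hA]
  refine cfc_congr fun x hx => ?_
  rw [hA.isHermitian.spectrum_real_eq_range_eigenvalues] at hx
  obtain ⟨i, rfl⟩ := hx
  simp only [Real.sqrt_inv, Real.sqrt_sq (hA.eigenvalues_pos i).le]

lemma posDef_cfc_inv_sq {A : Matrix (Fin d) (Fin d) ℝ} (hA : A.PosDef) :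
    (cfc (fun y : ℝ => (y ^ 2)⁻¹) A).PosDef := by
  have h : cfc (fun y : ℝ => (y ^ 2)⁻¹) A = A⁻¹ * A⁻¹ := by
    rw [← cfc_inv_eq hA, ← cfc_mul_matrix]
    simp only [pow_two, mul_inv]
  have h2 : A⁻¹ * A⁻¹ = A⁻¹ * (A⁻¹)ᴴ := by rw [hA.inv.isHermitian.eq]
  rw [h, h2]
  exact PosDef.mul_conjTranspose_self _ (vecMul_injective_iff_isUnit.2 hA.inv.isUnit)

lemma eigenvalues_pos_of_posDef_iff {A : Matrix (Fin d) (Fin d) ℝ} (hA : A.IsHermitian) :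
    (∀ i, hA.eigenvalues i ∈ Set.Ioi (0 : ℝ)) ↔ A.PosDef :=
  hA.posDef_iff_eigenvalues_pos.symm

lemma isHermitian_add_smul_one {H : Matrix (Fin d) (Fin d) ℝ} (hH : H.IsHermitian) (l : ℝ) :
    (H + l • 1).IsHermitian := by
  rw [IsHermitian, conjTranspose_add, hH.eq, conjTranspose_smul, conjTranspose_one, star_trivial]

lemma posDef_add_smul_one {H : Matrix (Fin d) (Fin d) ℝ} (hH : H.IsHermitian) {l : ℝ}
    (h : ∀ i, 0 < hH.eigenvalues i + l) : (H + l • 1).PosDef := by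
  rw [← cfc_add_const_eq hH, hH.cfc_eq, IsHermitian.cfc, Unitary.conjStarAlgAut_apply,
    star_eq_conjTranspose]
  refine PosDef.mul_mul_conjTranspose_same (PosDef.diagonal h) ?_
  exact vecMul_injective_iff_isUnit.2 (Unitary.isUnit_coe (U := hH.eigenvectorUnitary))

lemma ip_sum_smul {ι : Type*} {B : Matrix (Fin d) (Fin d) ℝ} (hB : B.PosSemidef) (α : ℝ)
    (s : Finset ι) (F : ι → Matrix (Fin d) (Fin d) ℝ) :
    α * ∑ i ∈ s, ip B (F i) = (B * (α • ∑ i ∈ s, F i)).trace := by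
  simp only [ip_eq_trace_mul hB, Matrix.mul_smul, Matrix.mul_sum, trace_smul, trace_sum,
    smul_eq_mul]

lemma entropy_step (hd : 1 ≤ d) {H E A : Matrix (Fin d) (Fin d) ℝ} (hH : H.IsHermitian)
    (hE : E.IsHermitian) (hA : A ∈ spectraplex d)
    (hmin : ∀ B ∈ spectraplex d,
      (A * H).trace + entropyReg A ≤ (B * H).trace + entropyReg B)
    {B : Matrix (Fin d) (Fin d) ℝ} (hB : B ∈ spectraplex d) :
    (A * H).trace + entropyReg A + (1 - ip A (NormedSpace.exp (-E))) ≤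
      (B * H).trace + entropyReg B + (B * E).trace := by
  obtain ⟨l, hl⟩ := exists_shift_entropy hd hH.eigenvalues
  have hK := isHermitian_add_smul_one hH l
  have hK' := hK.add hE
  have htr : (cfc (fun y => Real.exp (-y)) (H + l • 1)).trace = 1 :=
    (trace_cfc_add_smul_one hH (fun y => Real.exp (-y)) l).trans hl
  have hAK := fenchelPair_entropy.minimizer hA hK (fun _ => Set.mem_univ _) htr fun B hB => by
    rw [← entropyReg_eq_trace_cfc hA.1, ← entropyReg_eq_trace_cfc hB.1]
    exact hmin B hB
  have hstep := fenchelPair_entropy.step hA hB hK (fun _ => Set.mem_univ _) hAK hK'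
    (fun _ => Set.mem_univ _)
  rw [← entropyReg_eq_trace_cfc hA.1, ← entropyReg_eq_trace_cfc hB.1, htr, cfc_exp_neg hK',
    neg_add] at hstep
  -- Golden–Thompson separates E from H + l, and exp(-(H + l)) is A.
  have hgt := trace_exp_add_le (X := -(H + l • 1)) (Y := -E) hK.neg hE.neg
  rw [← cfc_exp_neg hK, ← hAK, ← ip_eq_trace_mul hA.1] at hgt
  linarith

/-- Here A = (H + l)⁻² with H + l positive definite, so A is too. Semidefiniteness of E keeps H + l
+ E positive definite, where the dual function 1/y is valid. -/
lemma half_step (hd : 1 ≤ d) {H E A : Matrix (Fin d) (Fin d) ℝ} (hH : H.IsHermitian)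
    (hE : E.PosSemidef) (hA : A ∈ spectraplex d)
    (hmin : ∀ B ∈ spectraplex d, (A * H).trace + halfReg A ≤ (B * H).trace + halfReg B) :
    A.PosDef ∧ ∀ B ∈ spectraplex d,
      (A * H).trace + halfReg A + (matSqrt A - ((matSqrt A)⁻¹ + E)⁻¹).trace ≤
        (B * H).trace + halfReg B + (B * E).trace := by
  obtain ⟨l, hpos, hl⟩ := exists_shift_half hd hH.eigenvalues
  have hK := posDef_add_smul_one hH hpos
  have hK' := hK.add_posSemidef hE
  have hAK := fenchelPair_half.minimizer hA hK.isHermitian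
    ((eigenvalues_pos_of_posDef_iff _).2 hK)
    ((trace_cfc_add_smul_one hH (fun y => (y ^ 2)⁻¹) l).trans hl) fun B hB => by
      rw [← halfReg_eq_trace_cfc hA.1, ← halfReg_eq_trace_cfc hB.1]
      exact hmin B hB
  have hsqrt : matSqrt A = (H + l • 1)⁻¹ := by rw [hAK, matSqrt_cfc_inv_sq hK]
  refine ⟨hAK ▸ posDef_cfc_inv_sq hK, fun B hB => ?_⟩
  have hstep := fenchelPair_half.step hA hB hK.isHermitian
    ((eigenvalues_pos_of_posDef_iff _).2 hK) hAK hK'.isHermitian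
    ((eigenvalues_pos_of_posDef_iff _).2 hK')
  rw [← halfReg_eq_trace_cfc hA.1, ← halfReg_eq_trace_cfc hB.1, cfc_inv_eq hK,
    cfc_inv_eq hK'] at hstep
  rw [hsqrt, nonsing_inv_nonsing_inv _ ((isUnit_iff_isUnit_det _).1 hK.isUnit), trace_sub]
  exact hstep

lemma IsFTRL.trace_le {k : ℕ} {w : Matrix (Fin d) (Fin d) ℝ → ℝ} {α : ℝ}
    {A F : Fin k → Matrix (Fin d) (Fin d) ℝ} (h : IsFTRL w α A F) (t : Fin k)
    {B : Matrix (Fin d) (Fin d) ℝ} (hB : B ∈ spectraplex d) :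
    (A t * (α • ∑ s ∈ Finset.Iio t, F s)).trace + w (A t) ≤
      (B * (α • ∑ s ∈ Finset.Iio t, F s)).trace + w B := by
  have := isMinOn_iff.1 (h t).2 B hB
  rwa [ip_sum_smul (h t).1.1, ip_sum_smul hB.1] at this

end FTRL

theorem proposition3p4 (d k : ℕ) (hd : 1 ≤ d) (α : ℝ) (hα : 0 < α)
    (A F : Fin k → Matrix (Fin d) (Fin d) ℝ) (hF : ∀ t, (F t).PosSemidef) :
    (FTRL.IsFTRL FTRL.entropyReg α A F →
      FTRL.regret A F ≤ Real.log d / α + ∑ t, FTRL.ip (A t) (F t)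
        - 1 / α * ∑ t, (1 - FTRL.ip (A t) (NormedSpace.exp (-α • F t)))) ∧
    (FTRL.IsFTRL FTRL.halfReg α A F →
      (∀ t, (A t).PosDef) ∧
      FTRL.regret A F ≤ 2 * Real.sqrt d / α + ∑ t, FTRL.ip (A t) (F t)
        - 1 / α * ∑ t, (FTRL.matSqrt (A t)
            - ((FTRL.matSqrt (A t))⁻¹ + α • F t)⁻¹).trace) := by
  have hH : ∀ t : Fin k, (α • ∑ s ∈ Finset.Iio t, F s).IsHermitian := fun t =>
    ((Matrix.posSemidef_sum _ fun s _ => hF s).smul hα.le).isHermitian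
  have hE : ∀ t, (α • F t).PosSemidef := fun t => (hF t).smul hα.le
  have hip : ∀ t, ∀ B ∈ FTRL.spectraplex d,
      α * FTRL.ip B (F t) = (B * (α • F t)).trace := fun t B hB => by
    rw [FTRL.ip_eq_trace_mul hB.1, Matrix.mul_smul, Matrix.trace_smul, smul_eq_mul]
  refine ⟨fun h => ?_, fun h => ?_⟩
  · have hreg := FTRL.regret_le_of_step (w := FTRL.entropyReg) hα (FTRL.spectraplex_nonempty hd)
      (fun t => 1 - FTRL.ip (A t) (NormedSpace.exp (-α • F t))) (fun t => (h t).1)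
      (fun B => FTRL.neg_log_sub_one_le_entropyReg hd) (fun B => FTRL.entropyReg_le)
      fun t B hB => by
        rw [FTRL.ip_sum_smul (h t).1.1, FTRL.ip_sum_smul hB.1, hip t B hB, neg_smul]
        exact FTRL.entropy_step hd (hH t) (hE t).isHermitian (h t).1
          (fun B hB => h.trace_le t hB) hB
    rwa [show (-1 : ℝ) - (-Real.log d - 1) = Real.log d by ring] at hreg
  · have hs := fun t => FTRL.half_step hd (hH t) (hE t) (h t).1 fun B hB => h.trace_le t hB
    refine ⟨fun t => (hs t).1, ?_⟩
    have hreg := FTRL.regret_le_of_step (w := FTRL.halfReg) hα (FTRL.spectraplex_nonempty hd)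
      (fun t => (FTRL.matSqrt (A t) - ((FTRL.matSqrt (A t))⁻¹ + α • F t)⁻¹).trace)
      (fun t => (h t).1) (fun B => FTRL.neg_two_mul_sqrt_le_halfReg hd)
      (fun B => FTRL.halfReg_nonpos) fun t B hB => by
        rw [FTRL.ip_sum_smul (h t).1.1, FTRL.ip_sum_smul hB.1, hip t B hB]
        exact (hs t).2 B hB
    rwa [zero_sub, neg_neg] at hreg
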